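/- **Conventions.** A groupoid $\mathcal G$ is identified with its set of arrows; its unit space $\mathcal G^0\subseteq\mathcal G$ is the set of identity arrows, and $d,r\colon \mathcal G\to\mathcal G^0$ denote the domain and range maps. A topological groupoid is a groupoid with a topology for which $d$, $r$, multiplication (on composable pairs) and inversion are continuous, where $\mathcal G^0$ carries the subspace topology. It is *ample* if $d$ is a local homeomorphism and $\mathcal G^0$ is locally compact and Hausdorff with a basis of compact open sets. The space $\mathcal G$ need not be Hausdorff, second countable or topologically principal. A *local bisection* is an open set $U\subseteq\mathcal G$ such that $d|_U$ and $r|_U$ are homeomorphisms onto $d(U)$ and $r(U)$. For a field $K$, the *Steinberg algebra* $K\mathcal G$ is the $K$-span in $K^{\mathcal G}$ of the characteristic functions of compact local bisections, with the convolution product $(f*g)(\gamma)=\sum_{\alpha\beta=\gamma}f(\alpha)g(\beta)$; it is an associative, not necessarily unital, $K$-algebra. It is *simple* if it is non-zero and its only two-sided ideals are $0$ and $K\mathcal G$. An element $f\in K\mathcal G$ is *singular* if $\{\gamma\in\mathcal G : f(\gamma)\neq 0\}$ has empty interior in $\mathcal G$. Let $\mathrm{Iso}(\mathcal G)=\{g\in\mathcal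 G: d(g)=r(g)\}$. Then $\mathcal G$ is *effective* if $\mathcal G^0=\mathrm{Int}(\mathrm{Iso}(\mathcal G))$, and *topologically free* if $\mathrm{Int}(\mathrm{Iso}(\mathcal G)\setminus\mathcal G^0)=\emptyset$. The orbit of $x\in\mathcal G^0$ is $\{r(g): g\in\mathcal G,\ d(g)=x\}$, a subset of $\mathcal G^0$ is *invariant* if it is a union of orbits, and $\mathcal G$ is *minimal* if $\mathcal G^0$ has no proper, non-empty, open invariant subset. **Theorem.** Let $\mathcal G$ be a non-empty ample groupoid and $K$ a field. Then $K\mathcal G$ is simple if and only if 1. $\mathcal G$ is effective; 2. $\mathcal G$ is minimal; 3. $K\mathcal G$ has no non-zero singular functions. Moreover, effectiveness can be replaced by topological freeness in (1): $K\mathcal G$ is simple if and only if $\mathcal G$ is topologically free and minimal and $K\mathcal G$ has no non-zero singular functions. -/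

import Mathlib

/-- A groupoid, viewed as its set of arrows: `dom g` and `cod g` are the identity arrows at the
domain and at the range of `g`, and the product `g * h` is meaningful only when
`dom g = cod h`; its value at other pairs is irrelevant and is never used. -/
class ArrowGroupoid (G : Type*) extends Mul G, Inv G where
  dom : G → G
  cod : G → G
  dom_dom : ∀ g, dom (dom g) = dom g
  cod_dom : ∀ g, cod (dom g) = dom g
  dom_cod : ∀ g, dom (cod g) = cod g
  cod_cod : ∀ g, cod (cod g) = cod g
  dom_mul : ∀ g h, dom g = cod h → dom (g * h) = dom h
  cod_mul : ∀ g h, dom g = cod h → cod (g * h) = cod g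
  mul_assoc : ∀ g h k, dom g = cod h → dom h = cod k → g * h * k = g * (h * k)
  mul_dom : ∀ g, g * dom g = g
  cod_mul_self : ∀ g, cod g * g = g
  dom_inv : ∀ g, dom g⁻¹ = cod g
  cod_inv : ∀ g, cod g⁻¹ = dom g
  inv_mul : ∀ g, g⁻¹ * g = dom g
  mul_inv : ∀ g, g * g⁻¹ = cod g

namespace ArrowGroupoid

/-- The unit space `G⁰`, the set of identity arrows; it carries the subspace topology. -/
def unitSpace (G : Type*) [ArrowGroupoid G] : Set G := Set.range dom

/-- The domain map `d : G → G⁰`. -/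
def d {G : Type*} [ArrowGroupoid G] (g : G) : unitSpace G := ⟨dom g, g, rfl⟩

/-- The range map `r : G → G⁰`. -/
def r {G : Type*} [ArrowGroupoid G] (g : G) : unitSpace G := ⟨cod g, cod g, dom_cod g⟩

/-- A topological groupoid. -/
class IsTopologicalGroupoid (G : Type*) [TopologicalSpace G] [ArrowGroupoid G] : Prop where
  continuous_d : Continuous (d : G → unitSpace G)
  continuous_r : Continuous (r : G → unitSpace G)
  continuousOn_mul : ContinuousOn (fun p : G × G => p.1 * p.2) {p | d p.1 = r p.2}
  continuous_inv : Continuous (fun g : G => g⁻¹)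

/-- An étale groupoid with locally compact Hausdorff unit space. -/
class IsEtaleGroupoid (G : Type*) [TopologicalSpace G] [ArrowGroupoid G] : Prop
    extends IsTopologicalGroupoid G where
  isLocalHomeomorph_d : IsLocalHomeomorph (d : G → unitSpace G)
  t2Space_unitSpace : T2Space (unitSpace G)
  locallyCompactSpace_unitSpace : LocallyCompactSpace (unitSpace G)

/-- An ample groupoid: an étale groupoid whose unit space has a basis of compact open sets.
The space `G` itself need not be Hausdorff. -/
class IsAmpleGroupoid (G : Type*) [TopologicalSpace G] [ArrowGroupoid G] : Prop
    extends IsEtaleGroupoid G where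
  isTopologicalBasis_unitSpace :
    TopologicalSpace.IsTopologicalBasis {U : Set (unitSpace G) | IsCompact U ∧ IsOpen U}

/-- The isotropy subgroupoid. -/
def isotropy (G : Type*) [ArrowGroupoid G] : Set G := {g | d g = r g}

def IsEffective (G : Type*) [TopologicalSpace G] [ArrowGroupoid G] : Prop :=
  unitSpace G = interior (isotropy G)

def IsTopologicallyFree (G : Type*) [TopologicalSpace G] [ArrowGroupoid G] : Prop :=
  interior (isotropy G \ unitSpace G) = ∅

def orbit {G : Type*} [ArrowGroupoid G] (x : unitSpace G) : Set (unitSpace G) :=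
  {y | ∃ g : G, d g = x ∧ r g = y}

/-- A set of units is invariant if it is a union of orbits, that is, if it contains the orbit of
each of its points. -/
def IsInvariant {G : Type*} [ArrowGroupoid G] (X : Set (unitSpace G)) : Prop :=
  ∀ x ∈ X, orbit x ⊆ X

/-- There is no proper non-empty open invariant set of units. -/
def IsMinimal (G : Type*) [TopologicalSpace G] [ArrowGroupoid G] : Prop :=
  ∀ X : Set (unitSpace G), IsOpen X → IsInvariant X → X = ∅ ∨ X = Set.univ

/-- A local bisection: an open set on which `d` and `r` are homeomorphisms onto their images. -/
structure IsLocalBisection {G : Type*} [TopologicalSpace G] [ArrowGroupoid G] (U : Set G) :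
    Prop where
  isOpen : IsOpen U
  isEmbedding_d : Topology.IsEmbedding (fun g : U => d (g : G))
  isEmbedding_r : Topology.IsEmbedding (fun g : U => r (g : G))

/-- The product `UV` of two sets of arrows. -/
def setMul {G : Type*} [ArrowGroupoid G] (U V : Set G) : Set G :=
  {g | ∃ u ∈ U, ∃ v ∈ V, d u = r v ∧ u * v = g}

open Classical in
/-- The characteristic function of a set. -/
noncomputable def chi (K : Type*) [CommRing K] {G : Type*} (U : Set G) : G → K :=
  fun g => if g ∈ U then 1 else 0

/-- The Steinberg algebra `KG`, as a submodule of the module of all functions `G → K`. -/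
def SteinbergAlgebra (K : Type*) [CommRing K] (G : Type*) [TopologicalSpace G]
    [ArrowGroupoid G] : Submodule K (G → K) :=
  Submodule.span K {f | ∃ U : Set G, IsLocalBisection U ∧ IsCompact U ∧ f = chi K U}

/-- The convolution `(f * g)(γ) = ∑ f(α) g(β)`, over the composable pairs with `αβ = γ`. For
`f` and `g` in the Steinberg algebra only finitely many terms are non-zero. -/
noncomputable def conv {K : Type*} [CommRing K] {G : Type*} [ArrowGroupoid G] (f g : G → K) :
    G → K :=
  fun γ => ∑ᶠ p : {p : G × G // d p.1 = r p.2 ∧ p.1 * p.2 = γ}, f p.1.1 * g p.1.2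

theorem zero_conv
    {K : Type*} [CommRing K] {G : Type*} [ArrowGroupoid G] (g : G → K) : conv (0 : G → K) g = 0 := by
  funext γ
  simp [conv]

theorem conv_zero
    {K : Type*} [CommRing K] {G : Type*} [ArrowGroupoid G] (f : G → K) : conv f (0 : G → K) = 0 := by
  funext γ
  simp [conv]

section algebra

variable {G : Type*} [ArrowGroupoid G]

theorem d_mul {g h : G} (H : d g = r h) : d (g * h) = d h :=
  Subtype.ext (dom_mul g h (Subtype.ext_iff.1 H))

theorem r_mul {g h : G} (H : d g = r h) : r (g * h) = r g :=
  Subtype.ext (cod_mul g h (Subtype.ext_iff.1 H))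

theorem d_inv (g : G) : d g⁻¹ = r g := Subtype.ext (dom_inv g)

theorem r_inv (g : G) : r g⁻¹ = d g := Subtype.ext (cod_inv g)

theorem assoc {g h k : G} (H : d g = r h) (H' : d h = r k) : g * h * k = g * (h * k) :=
  mul_assoc g h k (Subtype.ext_iff.1 H) (Subtype.ext_iff.1 H')

theorem inv_mul_cancel_left {g h : G} (H : d g = r h) : g⁻¹ * (g * h) = h := by
  rw [← assoc (d_inv g) H, inv_mul]
  have : dom g = cod h := Subtype.ext_iff.1 H
  rw [this, cod_mul_self]

theorem mul_inv_cancel_left {g h : G} (H : r g = r h) : g * (g⁻¹ * h) = h := by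
  rw [← assoc (r_inv g).symm ((d_inv g).trans H), mul_inv]
  have : cod g = cod h := Subtype.ext_iff.1 H
  rw [this, cod_mul_self]

theorem inv_inv (g : G) : g⁻¹⁻¹ = g := by
  have h := inv_mul_cancel_left (g := g⁻¹) (h := g) (d_inv g)
  rw [inv_mul] at h
  have e : dom g = dom g⁻¹⁻¹ := by rw [dom_inv, cod_inv]
  rw [← h]
  conv_rhs => rw [e, mul_dom]
  rw [h]

theorem setMul_assoc (U V W : Set G) : setMul (setMul U V) W = setMul U (setMul V W) := by
  ext g
  constructor
  · rintro ⟨_, ⟨u, hu, v, hv, huv, rfl⟩, w, hw, h, rfl⟩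
    rw [d_mul huv] at h
    exact ⟨u, hu, v * w, ⟨v, hv, w, hw, h, rfl⟩, huv.trans (r_mul h).symm, (assoc huv h).symm⟩
  · rintro ⟨u, hu, _, ⟨v, hv, w, hw, hvw, rfl⟩, h, rfl⟩
    rw [r_mul hvw] at h
    exact ⟨u * v, ⟨u, hu, v, hv, h, rfl⟩, w, hw, (d_mul h).trans hvw, assoc h hvw⟩

end algebra

section topology

variable {G : Type*} [TopologicalSpace G] [ArrowGroupoid G]

theorem IsLocalBisection.injOn_d {U : Set G} (hU : IsLocalBisection U) : Set.InjOn d U :=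
  fun x hx y hy h => congrArg Subtype.val (hU.isEmbedding_d.injective (a₁ := ⟨x, hx⟩)
    (a₂ := ⟨y, hy⟩) h)

theorem IsLocalBisection.injOn_r {U : Set G} (hU : IsLocalBisection U) : Set.InjOn r U :=
  fun x hx y hy h => congrArg Subtype.val (hU.isEmbedding_r.injective (a₁ := ⟨x, hx⟩)
    (a₂ := ⟨y, hy⟩) h)

theorem isOpenMap_d [IsEtaleGroupoid G] : IsOpenMap (d : G → unitSpace G) :=
  IsEtaleGroupoid.isLocalHomeomorph_d.isOpenMap

theorem isOpenMap_r [IsEtaleGroupoid G] : IsOpenMap (r : G → unitSpace G) := by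
  intro U hU
  have h : r '' U = d '' ((fun g : G => g⁻¹) ⁻¹' U) := by
    ext x
    constructor
    · rintro ⟨g, hg, rfl⟩
      exact ⟨g⁻¹, by simpa [inv_inv] using hg, d_inv g⟩
    · rintro ⟨g, hg, rfl⟩
      exact ⟨g⁻¹, hg, r_inv g⟩
  rw [h]
  exact isOpenMap_d _ (hU.preimage IsTopologicalGroupoid.continuous_inv)

theorem isLocalBisection_of_injOn [IsEtaleGroupoid G] {U : Set G} (hU : IsOpen U)
    (hd : Set.InjOn d U) (hr : Set.InjOn r U) : IsLocalBisection U where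
  isOpen := hU
  isEmbedding_d := (Topology.IsOpenEmbedding.of_continuous_injective_isOpenMap
    (IsTopologicalGroupoid.continuous_d.comp continuous_subtype_val)
    (fun x y h => Subtype.ext (hd x.2 y.2 h))
    (isOpenMap_d.comp hU.isOpenMap_subtype_val)).isEmbedding
  isEmbedding_r := (Topology.IsOpenEmbedding.of_continuous_injective_isOpenMap
    (IsTopologicalGroupoid.continuous_r.comp continuous_subtype_val)
    (fun x y h => Subtype.ext (hr x.2 y.2 h))
    (isOpenMap_r.comp hU.isOpenMap_subtype_val)).isEmbedding

theorem isOpen_setMul [IsEtaleGroupoid G] {U V : Set G} (hU : IsLocalBisection U)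
    (hV : IsOpen V) : IsOpen (setMul U V) := by
  have ho : Topology.IsOpenEmbedding (fun g : U => r (g : G)) :=
    Topology.IsOpenEmbedding.of_continuous_injective_isOpenMap hU.isEmbedding_r.continuous
      hU.isEmbedding_r.injective (isOpenMap_r.comp hU.isOpen.isOpenMap_subtype_val)
  rw [isOpen_iff_mem_nhds]
  rintro _ ⟨u, hu, v, hv, huv, rfl⟩
  let e := ho.isEmbedding.toHomeomorph
  let W : Set G := {g | r g ∈ Set.range (fun g : U => r (g : G))}
  have hW : IsOpen W := ho.isOpen_range.preimage IsTopologicalGroupoid.continuous_r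
  let s : W → G := fun g => (e.symm ⟨r (g : G), g.2⟩ : U)
  have hs : Continuous s := continuous_subtype_val.comp (e.symm.continuous.comp
    ((IsTopologicalGroupoid.continuous_r.comp continuous_subtype_val).subtype_mk _))
  have hsU : ∀ g : W, s g ∈ U := fun g => (e.symm ⟨r (g : G), g.2⟩ : U).2
  have hsr : ∀ g : W, r (s g) = r (g : G) := fun g =>
    congrArg Subtype.val (e.apply_symm_apply ⟨r (g : G), g.2⟩)
  have hc : Continuous (fun g : W => (s g)⁻¹ * (g : G)) :=
    IsTopologicalGroupoid.continuousOn_mul.comp_continuous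
      (f := fun g : W => ((s g)⁻¹, (g : G)))
      ((IsTopologicalGroupoid.continuous_inv.comp hs).prodMk continuous_subtype_val)
      (fun g => (d_inv _).trans (hsr g))
  have hopen : IsOpen (Subtype.val '' ((fun g : W => (s g)⁻¹ * (g : G)) ⁻¹' V)) :=
    hW.isOpenMap_subtype_val _ (hV.preimage hc)
  refine Filter.mem_of_superset (hopen.mem_nhds ?_) ?_
  · have hm : u * v ∈ W := ⟨⟨u, hu⟩, (r_mul huv).symm⟩
    refine ⟨⟨u * v, hm⟩, ?_, rfl⟩
    have hsu : s ⟨u * v, hm⟩ = u :=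
      hU.injOn_r (hsU _) hu ((hsr _).trans (r_mul huv))
    change (s ⟨u * v, hm⟩)⁻¹ * (u * v) ∈ V
    rw [hsu, inv_mul_cancel_left huv]
    exact hv
  · rintro _ ⟨g, hg, rfl⟩
    refine ⟨s g, hsU g, (s g)⁻¹ * (g : G), hg, ?_, mul_inv_cancel_left (hsr g)⟩
    rw [r_mul ((d_inv _).trans (hsr g)), r_inv]

theorem isCompact_setMul [IsEtaleGroupoid G] {U V : Set G} (hU : IsCompact U)
    (hV : IsCompact V) : IsCompact (setMul U V) := by
  have := IsEtaleGroupoid.t2Space_unitSpace (G := G)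
  have hcl : IsClosed {p : G × G | d p.1 = r p.2} :=
    isClosed_eq (IsTopologicalGroupoid.continuous_d.comp continuous_fst)
      (IsTopologicalGroupoid.continuous_r.comp continuous_snd)
  have h := ((hU.prod hV).inter_right hcl).image_of_continuousOn
    (IsTopologicalGroupoid.continuousOn_mul.mono Set.inter_subset_right)
  convert! h using 1
  ext g
  constructor
  · rintro ⟨u, hu, v, hv, huv, rfl⟩
    exact ⟨(u, v), ⟨⟨hu, hv⟩, huv⟩, rfl⟩
  · rintro ⟨⟨u, v⟩, ⟨⟨hu, hv⟩, huv⟩, rfl⟩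
    exact ⟨u, hu, v, hv, huv, rfl⟩

theorem IsLocalBisection.setMul [IsEtaleGroupoid G] {U V : Set G} (hU : IsLocalBisection U)
    (hV : IsLocalBisection V) : IsLocalBisection (setMul U V) := by
  refine isLocalBisection_of_injOn (isOpen_setMul hU hV.isOpen) ?_ ?_
  · rintro _ ⟨u, hu, v, hv, huv, rfl⟩ _ ⟨u', hu', v', hv', huv', rfl⟩ h
    rw [d_mul huv, d_mul huv'] at h
    obtain rfl := hV.injOn_d hv hv' h
    obtain rfl := hU.injOn_d hu hu' (huv.trans huv'.symm)
    rfl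
  · rintro _ ⟨u, hu, v, hv, huv, rfl⟩ _ ⟨u', hu', v', hv', huv', rfl⟩ h
    rw [r_mul huv, r_mul huv'] at h
    obtain rfl := hU.injOn_r hu hu' h
    obtain rfl := hV.injOn_r hv hv' (huv.symm.trans huv')
    rfl

end topology

section convolution

variable {K : Type*} [CommRing K] {G : Type*} [TopologicalSpace G] [ArrowGroupoid G]

theorem chi_mem {U : Set G} (hU : IsLocalBisection U) (hc : IsCompact U) :
    chi K U ∈ SteinbergAlgebra K G :=
  Submodule.subset_span ⟨U, hU, hc, rfl⟩

theorem finite_fiber {f : G → K} (hf : f ∈ SteinbergAlgebra K G) (x : unitSpace G) :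
    {g | r g = x ∧ f g ≠ 0}.Finite := by
  induction hf using Submodule.span_induction with
  | mem f hf =>
    obtain ⟨U, hU, -, rfl⟩ := hf
    refine Set.Subsingleton.finite ?_
    rintro g ⟨hg, hg'⟩ h ⟨hh, hh'⟩
    have hgU : g ∈ U := by by_contra hn; simp [chi, hn] at hg'
    have hhU : h ∈ U := by by_contra hn; simp [chi, hn] at hh'
    exact hU.injOn_r hgU hhU (hg.trans hh.symm)
  | zero => simp
  | add f f' _ _ h h' =>
    refine (h.union h').subset ?_
    rintro g ⟨hg, hg'⟩
    by_cases h0 : f g = 0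
    · exact Or.inr ⟨hg, fun h1 => hg' (by simp [h0, h1])⟩
    · exact Or.inl ⟨hg, h0⟩
  | smul c f _ h =>
    refine h.subset ?_
    rintro g ⟨hg, hg'⟩
    exact ⟨hg, fun h0 => hg' (by simp [h0])⟩

theorem conv_support_finite {f : G → K} (hf : f ∈ SteinbergAlgebra K G) (g : G → K) (γ : G) :
    (Function.support fun p : {p : G × G // d p.1 = r p.2 ∧ p.1 * p.2 = γ} =>
      f p.1.1 * g p.1.2).Finite := by
  refine Set.Finite.of_finite_image (f := fun p => p.1.1)
    ((finite_fiber hf (r γ)).subset ?_) ?_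
  · rintro _ ⟨⟨⟨a, b⟩, h, rfl⟩, hp, rfl⟩
    exact ⟨(r_mul h).symm, fun h0 => hp (by simp [show f a = 0 from h0])⟩
  · rintro ⟨⟨a, b⟩, h, hm⟩ - ⟨⟨a', b'⟩, h', hm'⟩ - (rfl : a = a')
    have : b = b' := by
      have h1 : a * b = a * b' := hm.trans hm'.symm
      have h2 := inv_mul_cancel_left (g := a) (h := b) h
      rw [h1, inv_mul_cancel_left (g := a) (h := b') h'] at h2
      exact h2.symm
    subst this
    rfl

theorem conv_add_left {f f' : G → K} (hf : f ∈ SteinbergAlgebra K G)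
    (hf' : f' ∈ SteinbergAlgebra K G) (g : G → K) :
    conv (f + f') g = conv f g + conv f' g := by
  funext γ
  simp only [conv, Pi.add_apply, add_mul]
  exact finsum_add_distrib (conv_support_finite hf g γ) (conv_support_finite hf' g γ)

theorem conv_add_right {f : G → K} (hf : f ∈ SteinbergAlgebra K G) (g g' : G → K) :
    conv f (g + g') = conv f g + conv f g' := by
  funext γ
  simp only [conv, Pi.add_apply, mul_add]
  exact finsum_add_distrib (conv_support_finite hf g γ) (conv_support_finite hf g' γ)

theorem conv_smul_left (c : K) {f : G → K} (hf : f ∈ SteinbergAlgebra K G) (g : G → K) :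
    conv (c • f) g = c • conv f g := by
  funext γ
  simp only [conv, Pi.smul_apply, smul_mul_assoc]
  exact (smul_finsum' c (conv_support_finite hf g γ)).symm

theorem conv_smul_right (c : K) {f : G → K} (hf : f ∈ SteinbergAlgebra K G) (g : G → K) :
    conv f (c • g) = c • conv f g := by
  funext γ
  simp only [conv, Pi.smul_apply, mul_smul_comm]
  exact (smul_finsum' c (conv_support_finite hf g γ)).symm

theorem chi_conv_chi {U V : Set G} (hU : IsLocalBisection U) :
    conv (chi K U) (chi K V) = chi K (setMul U V) := by
  funext γ
  by_cases h : γ ∈ setMul U V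
  · obtain ⟨u, hu, v, hv, huv, rfl⟩ := h
    rw [conv, finsum_eq_single _ ⟨(u, v), huv, rfl⟩]
    · simp [chi, hu, hv, show u * v ∈ setMul U V from ⟨u, hu, v, hv, huv, rfl⟩]
    · rintro ⟨⟨a, b⟩, hab, hm⟩ hne
      by_cases ha : a ∈ U
      · exfalso
        apply hne
        change a * b = u * v at hm
        have : a = u := hU.injOn_r ha hu (by rw [← r_mul hab, ← r_mul huv, hm])
        subst this
        have : b = v := by
          have h2 := inv_mul_cancel_left (g := a) (h := b) hab
          rw [hm, inv_mul_cancel_left huv] at h2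
          exact h2.symm
        subst this
        rfl
      · simp [chi, ha]
  · rw [conv]
    simp only [chi, h, if_false]
    apply finsum_eq_zero_of_forall_eq_zero
    rintro ⟨⟨a, b⟩, hab, rfl⟩
    by_cases ha : a ∈ U
    · by_cases hb : b ∈ V
      · exact absurd ⟨a, ha, b, hb, hab, rfl⟩ h
      · simp [hb]
    · simp [ha]

theorem conv_mem [IsEtaleGroupoid G] {f g : G → K} (hf : f ∈ SteinbergAlgebra K G)
    (hg : g ∈ SteinbergAlgebra K G) : conv f g ∈ SteinbergAlgebra K G := by
  induction hf using Submodule.span_induction with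
  | mem f hf =>
    obtain ⟨U, hU, hUc, rfl⟩ := hf
    induction hg using Submodule.span_induction with
    | mem g hg =>
      obtain ⟨V, hV, hVc, rfl⟩ := hg
      rw [chi_conv_chi hU]
      exact chi_mem (hU.setMul hV) (isCompact_setMul hUc hVc)
    | zero => rw [conv_zero]; exact Submodule.zero_mem _
    | add g g' _ _ h h' =>
      rw [conv_add_right (chi_mem hU hUc)]
      exact Submodule.add_mem _ h h'
    | smul c g _ h =>
      rw [conv_smul_right c (chi_mem hU hUc)]
      exact Submodule.smul_mem _ c h
  | zero => rw [zero_conv]; exact Submodule.zero_mem _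
  | add f f' hf hf' h h' =>
    rw [conv_add_left hf hf']
    exact Submodule.add_mem _ h h'
  | smul c f hf h =>
    rw [conv_smul_left c hf]
    exact Submodule.smul_mem _ c h

theorem conv_assoc [IsEtaleGroupoid G] {f g h : G → K} (hf : f ∈ SteinbergAlgebra K G)
    (hg : g ∈ SteinbergAlgebra K G) (hh : h ∈ SteinbergAlgebra K G) :
    conv (conv f g) h = conv f (conv g h) := by
  induction hf using Submodule.span_induction with
  | mem f hf =>
    obtain ⟨U, hU, hUc, rfl⟩ := hf
    have hUm : chi K U ∈ SteinbergAlgebra K G := chi_mem hU hUc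
    induction hg using Submodule.span_induction with
    | mem g hg =>
      obtain ⟨V, hV, hVc, rfl⟩ := hg
      have hVm : chi K V ∈ SteinbergAlgebra K G := chi_mem hV hVc
      induction hh using Submodule.span_induction with
      | mem h hh =>
        obtain ⟨W, hW, hWc, rfl⟩ := hh
        rw [chi_conv_chi hU, chi_conv_chi hV, chi_conv_chi (hU.setMul hV), chi_conv_chi hU,
          setMul_assoc]
      | zero => simp only [conv_zero]
      | add h h' _ _ e e' =>
        rw [conv_add_right (conv_mem hUm hVm), conv_add_right hVm, conv_add_right hUm, e, e']
      | smul c h _ e =>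
        rw [conv_smul_right c (conv_mem hUm hVm), conv_smul_right c hVm, conv_smul_right c hUm,
          e]
    | zero => simp only [conv_zero, zero_conv]
    | add g g' hg hg' e e' =>
      rw [conv_add_right hUm, conv_add_left (conv_mem hUm hg) (conv_mem hUm hg'),
        conv_add_left hg hg', conv_add_right hUm, e, e']
    | smul c g hg e =>
      rw [conv_smul_right c hUm, conv_smul_left c (conv_mem hUm hg), conv_smul_left c hg,
        conv_smul_right c hUm, e]
  | zero => simp only [zero_conv]
  | add f f' hf hf' e e' =>
    rw [conv_add_left hf hf', conv_add_left (conv_mem hf hg) (conv_mem hf' hg),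
      conv_add_left hf hf', e, e']
  | smul c f hf e =>
    rw [conv_smul_left c hf, conv_smul_left c (conv_mem hf hg), conv_smul_left c hf, e]

/-- The Steinberg algebra is an associative ring, in general without unit, under convolution. -/
noncomputable instance instNonUnitalRingSteinbergAlgebra [IsEtaleGroupoid G] :
    NonUnitalRing (SteinbergAlgebra K G) where
  mul f g := ⟨conv f.1 g.1, conv_mem f.2 g.2⟩
  left_distrib f g h := Subtype.ext (conv_add_right f.2 g.1 h.1)
  right_distrib f g h := Subtype.ext (conv_add_left f.2 g.2 h.1)
  zero_mul f := Subtype.ext (zero_conv f.1)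
  mul_zero f := Subtype.ext (conv_zero f.1)
  mul_assoc f g h := Subtype.ext (conv_assoc f.2 g.2 h.2)

instance instIsScalarTowerSteinbergAlgebra [IsEtaleGroupoid G] :
    IsScalarTower K (SteinbergAlgebra K G) (SteinbergAlgebra K G) :=
  ⟨fun c f g => Subtype.ext (conv_smul_left c f.2 g.1)⟩

instance instSMulCommClassSteinbergAlgebra [IsEtaleGroupoid G] :
    SMulCommClass K (SteinbergAlgebra K G) (SteinbergAlgebra K G) :=
  ⟨fun c f g => Subtype.ext (conv_smul_right c f.2 g.1).symm⟩

/-- A function on `G` is singular if its support (no closure is taken) has empty interior. -/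
def IsSingular (f : G → K) : Prop := interior (Function.support f) = ∅

end convolution

end ArrowGroupoid

/-! Necessity: each condition that fails produces an ideal that is neither zero nor everything.
Singular functions lie in `singularIdeal`, which contains no characteristic function of a non-empty
bisection. An open invariant set `X` of units gives `supportedIdeal K X`, the functions living over
`X`. For effectiveness, the algebra acts on finitely supported functions on the unit space, with
`arrowSum f x y` as matrix coefficients. A compact bisection `U` of isotropy arrows acts like its
set of domains `dom '' U`, so if `U` contains a non-unit then the difference of the two
characteristic functions is a non-zero element of `actionKernel`.

Sufficiency needs only topological freeness. A non-zero element of an ideal `I` is non-singular,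
hence equal to a constant `c ≠ 0` on some open bisection `W`; multiplying by the characteristic
function of the inverse of `W` moves this value to units. Topological freeness allows cutting down
to a small open `V` where only the units survive, so `chi K V` lies in `I`
(`IsTopologicallyFree.exists_chi_mem`). The units reached in this way form an open invariant set,
which by minimality is the whole unit space, and compactness then puts every generator in `I`. -/

namespace ArrowGroupoid

/-! ### Arithmetic of arrows and inverses of sets -/

section arrows

variable {G : Type*} [ArrowGroupoid G]

theorem d_eq_r_iff {g h : G} : d g = r h ↔ dom g = cod h := Subtype.ext_iff

theorem d_eq_d_iff {g h : G} : d g = d h ↔ dom g = dom h := Subtype.ext_iff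

theorem r_eq_r_iff {g h : G} : r g = r h ↔ cod g = cod h := Subtype.ext_iff

theorem dom_mem_unitSpace (g : G) : dom g ∈ unitSpace G := ⟨g, rfl⟩

theorem cod_mem_unitSpace (g : G) : cod g ∈ unitSpace G := ⟨cod g, dom_cod g⟩

theorem dom_of_mem_unitSpace {x : G} (hx : x ∈ unitSpace G) : dom x = x := by
  obtain ⟨g, rfl⟩ := hx
  exact dom_dom g

theorem cod_of_mem_unitSpace {x : G} (hx : x ∈ unitSpace G) : cod x = x := by
  obtain ⟨g, rfl⟩ := hx
  exact cod_dom g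

theorem mul_inv_cancel_right {g h : G} (H : d g = r h) : g * h * h⁻¹ = g := by
  rw [assoc H (r_inv h).symm, mul_inv, ← d_eq_r_iff.1 H, mul_dom]

theorem inv_mul_cancel_right {g h : G} (H : d g = d h) : g * h⁻¹ * h = g := by
  have := mul_inv_cancel_right (g := g) (h := h⁻¹) (H.trans (r_inv h).symm)
  rwa [inv_inv] at this

theorem mul_of_mem_unitSpace {g x : G} (hx : x ∈ unitSpace G) (h : d g = r x) : g * x = g := by
  rw [← cod_of_mem_unitSpace hx, ← d_eq_r_iff.1 h, mul_dom]

theorem unitSpace_subset_isotropy : unitSpace G ⊆ isotropy G := fun _ hx =>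
  d_eq_r_iff.2 ((dom_of_mem_unitSpace hx).trans (cod_of_mem_unitSpace hx).symm)

/-- The set of inverses of the arrows in `U`. -/
def setInv (U : Set G) : Set G := {g | g⁻¹ ∈ U}

theorem inv_mem_setInv {U : Set G} {g : G} (hg : g ∈ U) : g⁻¹ ∈ setInv U := by
  simpa [setInv, inv_inv] using hg

theorem setInv_eq_image (U : Set G) : setInv U = (fun g : G => g⁻¹) '' U := by
  ext g
  constructor
  · exact fun h => ⟨g⁻¹, h, inv_inv g⟩
  · rintro ⟨h, hh, rfl⟩
    exact inv_mem_setInv hh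

/-- Inversion exchanges the two factors, so the openness of products with a bisection on the left
carries over to products with a bisection on the right. -/
theorem setMul_eq_setInv (U V : Set G) : setMul U V = setInv (setMul (setInv V) (setInv U)) := by
  have key : ∀ {u v : G}, d u = r v → (u * v)⁻¹ = v⁻¹ * u⁻¹ := by
    intro u v h
    have h' : d v⁻¹ = r u⁻¹ := by rw [d_inv, r_inv, h]
    have h2 : u * (v * (v⁻¹ * u⁻¹)) = cod u := by
      have h3 : r v = r u⁻¹ := by rw [r_inv, h]
      rw [mul_inv_cancel_left h3, mul_inv]
    rw [← assoc h (by rw [r_mul h', r_inv])] at h2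
    have h3 := inv_mul_cancel_left (g := u * v) (h := v⁻¹ * u⁻¹)
      (by rw [d_mul h, r_mul h', r_inv])
    rw [h2] at h3
    have h4 : cod u = dom (u * v)⁻¹ := by rw [dom_inv, cod_mul _ _ (d_eq_r_iff.1 h)]
    rw [h4, mul_dom] at h3
    exact h3
  ext g
  constructor
  · rintro ⟨u, hu, v, hv, huv, rfl⟩
    exact ⟨v⁻¹, inv_mem_setInv hv, u⁻¹, inv_mem_setInv hu, by rw [d_inv, r_inv, huv],
      (key huv).symm⟩
  · rintro ⟨v, hv, u, hu, hvu, h⟩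
    have h1 : d u⁻¹ = r v⁻¹ := by rw [d_inv, r_inv, hvu]
    refine ⟨u⁻¹, hu, v⁻¹, hv, h1, ?_⟩
    have h2 := key h1
    rw [inv_inv, inv_inv, h] at h2
    rw [← inv_inv (u⁻¹ * v⁻¹), h2, inv_inv]

end arrows

/-! ### Openness of the unit space; the basis of compact local bisections -/

section topology

variable {G : Type*} [TopologicalSpace G] [ArrowGroupoid G]

theorem continuous_dom [IsTopologicalGroupoid G] : Continuous (dom : G → G) :=
  continuous_subtype_val.comp IsTopologicalGroupoid.continuous_d

theorem continuous_cod [IsTopologicalGroupoid G] : Continuous (cod : G → G) :=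
  continuous_subtype_val.comp IsTopologicalGroupoid.continuous_r

theorem isOpen_setInv [IsTopologicalGroupoid G] {U : Set G} (hU : IsOpen U) :
    IsOpen (setInv U) :=
  hU.preimage IsTopologicalGroupoid.continuous_inv

theorem isCompact_setInv [IsTopologicalGroupoid G] {U : Set G} (hU : IsCompact U) :
    IsCompact (setInv U) := by
  rw [setInv_eq_image]
  exact hU.image IsTopologicalGroupoid.continuous_inv

theorem IsLocalBisection.mono [IsEtaleGroupoid G] {U V : Set G} (hU : IsLocalBisection U)
    (hV : IsOpen V) (h : V ⊆ U) : IsLocalBisection V :=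
  isLocalBisection_of_injOn hV (hU.injOn_d.mono h) (hU.injOn_r.mono h)

theorem IsLocalBisection.setInv [IsEtaleGroupoid G] {U : Set G} (hU : IsLocalBisection U) :
    IsLocalBisection (setInv U) := by
  have key : ∀ {g h : G}, g⁻¹ = h⁻¹ → g = h := fun {g h} e => by
    rw [← inv_inv g, e, inv_inv]
  refine isLocalBisection_of_injOn (isOpen_setInv hU.isOpen) ?_ ?_
  · intro g hg h hh e
    exact key (hU.injOn_r hg hh (by rw [r_inv, r_inv, e]))
  · intro g hg h hh e
    exact key (hU.injOn_d hg hh (by rw [d_inv, d_inv, e]))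

theorem isOpen_setMul_of_isLocalBisection_right [IsEtaleGroupoid G] {U V : Set G}
    (hU : IsOpen U) (hV : IsLocalBisection V) : IsOpen (ArrowGroupoid.setMul U V) := by
  rw [setMul_eq_setInv]
  exact isOpen_setInv (isOpen_setMul hV.setInv (isOpen_setInv hU))

theorem exists_injOn_d [IsEtaleGroupoid G] (g : G) :
    ∃ U : Set G, IsOpen U ∧ g ∈ U ∧ Set.InjOn d U := by
  obtain ⟨e, he, hd⟩ := IsEtaleGroupoid.isLocalHomeomorph_d (G := G) g
  exact ⟨e.source, e.open_source, he, by rw [hd]; exact e.injOn⟩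

/-- Let `d` be injective on a neighbourhood `U` of a unit. If both `g` and `dom g` lie in `U`, they
have the same domain, so `g = dom g` is a unit. -/
theorem isOpen_unitSpace [IsEtaleGroupoid G] : IsOpen (unitSpace G) := by
  rw [isOpen_iff_mem_nhds]
  intro x hx
  obtain ⟨U, hU, hxU, hinj⟩ := exists_injOn_d x
  have hW : IsOpen (U ∩ dom ⁻¹' U) := hU.inter (hU.preimage continuous_dom)
  refine Filter.mem_of_superset
    (hW.mem_nhds ⟨hxU, by rwa [Set.mem_preimage, dom_of_mem_unitSpace hx]⟩) ?_
  rintro g ⟨hg, hg'⟩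
  have : g = dom g := hinj hg hg' (d_eq_d_iff.2 (dom_dom g).symm)
  exact ⟨g, this.symm⟩

theorem isLocalBisection_of_subset_unitSpace [IsEtaleGroupoid G] {V : Set G} (hV : IsOpen V)
    (h : V ⊆ unitSpace G) : IsLocalBisection V := by
  refine isLocalBisection_of_injOn hV ?_ ?_
  · intro x hx y hy e
    have := d_eq_d_iff.1 e
    rwa [dom_of_mem_unitSpace (h hx), dom_of_mem_unitSpace (h hy)] at this
  · intro x hx y hy e
    have := r_eq_r_iff.1 e
    rwa [cod_of_mem_unitSpace (h hx), cod_of_mem_unitSpace (h hy)] at this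

theorem isOpen_dom_image [IsEtaleGroupoid G] {U : Set G} (hU : IsOpen U) :
    IsOpen (dom '' U) := by
  have h := isOpen_unitSpace.isOpenMap_subtype_val _ (isOpenMap_d U hU)
  rwa [← Set.image_comp] at h

theorem isOpen_cod_image [IsEtaleGroupoid G] {U : Set G} (hU : IsOpen U) :
    IsOpen (cod '' U) := by
  have h := isOpen_unitSpace.isOpenMap_subtype_val _ (isOpenMap_r U hU)
  rwa [← Set.image_comp] at h

/-- The compact local bisections form a basis of the topology of an ample groupoid. -/
theorem exists_isCompact_isLocalBisection [IsAmpleGroupoid G] {W : Set G} (hW : IsOpen W) {g : G}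
    (hg : g ∈ W) : ∃ U ⊆ W, g ∈ U ∧ IsLocalBisection U ∧ IsCompact U := by
  obtain ⟨A, hA, hgA, hAd⟩ := exists_injOn_d g
  obtain ⟨B, hB, hgB, hBd⟩ := exists_injOn_d g⁻¹
  -- Injectivity of `d` on `B` gives injectivity of `r` on `setInv B`, so this intersection is a
  -- bisection.
  have hC : IsOpen (W ∩ A ∩ setInv B) := (hW.inter hA).inter (isOpen_setInv hB)
  have hgC : g ∈ W ∩ A ∩ setInv B := ⟨⟨hg, hgA⟩, hgB⟩
  have hCb : IsLocalBisection (W ∩ A ∩ setInv B) := by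
    refine isLocalBisection_of_injOn hC (hAd.mono fun x hx => hx.1.2) ?_
    intro x hx y hy e
    have := hBd hx.2 hy.2 (by rw [d_inv, d_inv, e])
    rw [← inv_inv x, this, inv_inv]
  obtain ⟨V, ⟨hVc, hVo⟩, hgV, hVC⟩ :=
    IsAmpleGroupoid.isTopologicalBasis_unitSpace.exists_subset_of_mem_open
      (show d g ∈ d '' (W ∩ A ∩ setInv B) from ⟨g, hgC, rfl⟩) (isOpenMap_d _ hC)
  have hUo : IsOpen (W ∩ A ∩ setInv B ∩ d ⁻¹' V) :=
    hC.inter (hVo.preimage IsTopologicalGroupoid.continuous_d)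
  have hUb := hCb.mono hUo Set.inter_subset_left
  refine ⟨W ∩ A ∩ setInv B ∩ d ⁻¹' V, fun x hx => hx.1.1.1, ⟨hgC, hgV⟩, hUb, ?_⟩
  rw [isCompact_iff_isCompact_univ, hUb.isEmbedding_d.isCompact_iff]
  convert hVc
  ext x
  constructor
  · rintro ⟨⟨y, hy⟩, -, rfl⟩
    exact hy.2
  · intro hx
    obtain ⟨y, hy, rfl⟩ := hVC hx
    exact ⟨⟨y, hy, hx⟩, trivial, rfl⟩

end topology

/-! ### Convolution by characteristic functions as translation and restriction -/

section convolution

variable {K : Type*} [CommRing K] {G : Type*} [ArrowGroupoid G]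

/-- As `r` is injective on `U`, the only factorisation of `u * γ` with left factor in `U` is the
given one: the convolution sum has a single relevant term, and multiplying by `chi K U` translates
functions along `U`. -/
theorem chi_conv_apply {U : Set G} (hU : Set.InjOn r U) (f : G → K) {u γ : G} (hu : u ∈ U)
    (h : d u = r γ) : conv (chi K U) f (u * γ) = f γ := by
  rw [conv, finsum_eq_single _ ⟨(u, γ), h, rfl⟩]
  · simp [chi, hu]
  · rintro ⟨⟨a, b⟩, hab, hm⟩ hne
    by_cases ha : a ∈ U
    · exfalso
      apply hne
      change a * b = u * γ at hm
      obtain rfl : a = u := hU ha hu (by rw [← r_mul hab, ← r_mul h, hm])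
      obtain rfl : b = γ := by
        rw [← inv_mul_cancel_left (g := a) (h := b) hab, hm, inv_mul_cancel_left h]
      rfl
    · simp [chi, ha]

theorem chi_conv_apply_eq_zero {U : Set G} (f : G → K) {γ : G} (h : ∀ u ∈ U, r u ≠ r γ) :
    conv (chi K U) f γ = 0 := by
  apply finsum_eq_zero_of_forall_eq_zero
  rintro ⟨⟨a, b⟩, hab, rfl⟩
  have ha : a ∉ U := fun ha => h a ha (r_mul hab).symm
  simp [chi, ha]

theorem conv_chi_apply {U : Set G} (hU : Set.InjOn d U) (f : G → K) {u γ : G} (hu : u ∈ U)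
    (h : d γ = r u) : conv f (chi K U) (γ * u) = f γ := by
  rw [conv, finsum_eq_single _ ⟨(γ, u), h, rfl⟩]
  · simp [chi, hu]
  · rintro ⟨⟨a, b⟩, hab, hm⟩ hne
    by_cases hb : b ∈ U
    · exfalso
      apply hne
      change a * b = γ * u at hm
      obtain rfl : b = u := hU hb hu (by rw [← d_mul hab, ← d_mul h, hm])
      obtain rfl : a = γ := by
        rw [← mul_inv_cancel_right (g := a) (h := b) hab, hm, mul_inv_cancel_right h]
      rfl
    · simp [chi, hb]

theorem conv_chi_apply_eq_zero {U : Set G} (f : G → K) {γ : G} (h : ∀ u ∈ U, d u ≠ d γ) :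
    conv f (chi K U) γ = 0 := by
  apply finsum_eq_zero_of_forall_eq_zero
  rintro ⟨⟨a, b⟩, hab, rfl⟩
  have hb : b ∉ U := fun hb => h b hb (d_mul hab).symm
  simp [chi, hb]

theorem injOn_r_of_subset_unitSpace {V : Set G} (h : V ⊆ unitSpace G) : Set.InjOn r V := by
  intro x hx y hy e
  have := r_eq_r_iff.1 e
  rwa [cod_of_mem_unitSpace (h hx), cod_of_mem_unitSpace (h hy)] at this

theorem injOn_d_of_subset_unitSpace {V : Set G} (h : V ⊆ unitSpace G) : Set.InjOn d V := by
  intro x hx y hy e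
  have := d_eq_d_iff.1 e
  rwa [dom_of_mem_unitSpace (h hx), dom_of_mem_unitSpace (h hy)] at this

theorem chi_conv_of_subset_unitSpace {V : Set G} (h : V ⊆ unitSpace G) (f : G → K) (γ : G) :
    conv (chi K V) f γ = chi K V (cod γ) * f γ := by
  by_cases hγ : cod γ ∈ V
  · have := chi_conv_apply (injOn_r_of_subset_unitSpace h) f (γ := γ) hγ
      (d_eq_r_iff.2 (dom_cod γ))
    rw [cod_mul_self] at this
    simp [this, chi, hγ]
  · rw [chi_conv_apply_eq_zero]
    · simp [chi, hγ]
    · intro u hu e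
      rw [r_eq_r_iff, cod_of_mem_unitSpace (h hu)] at e
      exact hγ (e ▸ hu)

theorem conv_chi_of_subset_unitSpace {V : Set G} (h : V ⊆ unitSpace G) (f : G → K) (γ : G) :
    conv f (chi K V) γ = f γ * chi K V (dom γ) := by
  by_cases hγ : dom γ ∈ V
  · have := conv_chi_apply (injOn_d_of_subset_unitSpace h) f (γ := γ) hγ
      (d_eq_r_iff.2 (cod_dom γ).symm)
    rw [mul_dom] at this
    simp [this, chi, hγ]
  · rw [conv_chi_apply_eq_zero]
    · simp [chi, hγ]
    · intro u hu e
      rw [d_eq_d_iff, dom_of_mem_unitSpace (h hu)] at e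
      exact hγ (e ▸ hu)

end convolution


/-! ### Sums over arrows between two units; generic local constancy -/

section functions

variable {K : Type*} [CommRing K] {G : Type*}

theorem chi_of_mem {U : Set G} {g : G} (h : g ∈ U) : chi K U g = 1 := by simp [chi, h]

theorem chi_of_notMem {U : Set G} {g : G} (h : g ∉ U) : chi K U g = 0 := by simp [chi, h]

section arrowSum

variable [ArrowGroupoid G]

/-- The sum of a function over the arrows from `x` to `y`. -/
noncomputable def arrowSum (f : G → K) (x y : unitSpace G) : K :=
  ∑ᶠ g ∈ {g : G | d g = x ∧ r g = y}, f g

theorem arrowSum_chi_eq_zero {U : Set G} {x y : unitSpace G}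
    (h : ∀ u ∈ U, d u = x → r u ≠ y) : arrowSum (chi K U) x y = 0 :=
  finsum_mem_eq_zero_of_forall_eq_zero fun g hg =>
    chi_of_notMem fun hgU => h g hgU hg.1 hg.2

end arrowSum

variable [TopologicalSpace G] [ArrowGroupoid G]

/-- An element of the Steinberg algebra is constant on some non-empty open subset of every
non-empty open set. -/
theorem exists_isOpen_forall_eq {f : G → K} (hf : f ∈ SteinbergAlgebra K G) :
    ∀ {W : Set G}, IsOpen W → W.Nonempty →
      ∃ W' ⊆ W, IsOpen W' ∧ W'.Nonempty ∧ ∃ c, ∀ g ∈ W', f g = c := by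
  induction hf using Submodule.span_induction with
  | mem f hf =>
    obtain ⟨U, hU, -, rfl⟩ := hf
    intro W hW hne
    -- Compact bisections need not be closed when `G` is not Hausdorff, so `chi K U` may fail to be
    -- locally constant; passing to a smaller open set avoids the boundary of `U`.
    by_cases h : (W ∩ U).Nonempty
    · exact ⟨W ∩ U, Set.inter_subset_left, hW.inter hU.isOpen, h, 1,
        fun g hg => chi_of_mem hg.2⟩
    · exact ⟨W, subset_rfl, hW, hne, 0, fun g hg => chi_of_notMem fun hg' => h ⟨g, hg, hg'⟩⟩
  | zero => exact fun {W} hW hne => ⟨W, subset_rfl, hW, hne, 0, fun _ _ => rfl⟩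
  | add f f' _ _ h h' =>
    intro W hW hne
    obtain ⟨W₁, h₁, ho₁, hne₁, c, hc⟩ := h hW hne
    obtain ⟨W₂, h₂, ho₂, hne₂, c', hc'⟩ := h' ho₁ hne₁
    exact ⟨W₂, h₂.trans h₁, ho₂, hne₂, c + c', fun g hg => by
      rw [Pi.add_apply, hc g (h₂ hg), hc' g hg]⟩
  | smul a f _ h =>
    intro W hW hne
    obtain ⟨W₁, h₁, ho₁, hne₁, c, hc⟩ := h hW hne
    exact ⟨W₁, h₁, ho₁, hne₁, a * c, fun g hg => by
      rw [Pi.smul_apply, hc g hg, smul_eq_mul]⟩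

end functions

/-! ### The three ideals used for necessity -/

section ideals

variable {K : Type*} [CommRing K] {G : Type*} [TopologicalSpace G] [ArrowGroupoid G]

theorem coe_mul_steinbergAlgebra [IsEtaleGroupoid G] (f g : SteinbergAlgebra K G) :
    ((f * g : SteinbergAlgebra K G) : G → K) = conv f.1 g.1 := rfl

/-- A submodule stable under convolution by characteristic functions of compact local bisections
is trivial if the Steinberg algebra is simple. -/
theorem eq_bot_or_eq_top_of_isSimpleRing [IsEtaleGroupoid G]
    (hs : IsSimpleRing (SteinbergAlgebra K G)) (J : Submodule K (SteinbergAlgebra K G))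
    (hl : ∀ (U : Set G) (hU : IsLocalBisection U) (hc : IsCompact U), ∀ f ∈ J,
      (⟨chi K U, chi_mem hU hc⟩ : SteinbergAlgebra K G) * f ∈ J)
    (hr : ∀ (U : Set G) (hU : IsLocalBisection U) (hc : IsCompact U), ∀ f ∈ J,
      f * (⟨chi K U, chi_mem hU hc⟩ : SteinbergAlgebra K G) ∈ J) :
    J = ⊥ ∨ J = ⊤ := by
  have hl' : ∀ (x y : SteinbergAlgebra K G), y ∈ J → x * y ∈ J := by
    rintro ⟨x, hx⟩ y hy
    induction hx using Submodule.span_induction with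
    | mem f hf =>
      obtain ⟨U, hU, hc, rfl⟩ := hf
      exact hl U hU hc y hy
    | zero =>
      change (0 : SteinbergAlgebra K G) * y ∈ J
      rw [zero_mul]
      exact J.zero_mem
    | add f f' h h' e e' =>
      change ((⟨f, h⟩ : SteinbergAlgebra K G) + ⟨f', h'⟩) * y ∈ J
      rw [add_mul]
      exact J.add_mem e e'
    | smul c f h e =>
      change (c • (⟨f, h⟩ : SteinbergAlgebra K G)) * y ∈ J
      rw [smul_mul_assoc]
      exact J.smul_mem c e
  have hr' : ∀ (x y : SteinbergAlgebra K G), x ∈ J → x * y ∈ J := by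
    rintro x ⟨y, hy⟩ hx
    induction hy using Submodule.span_induction with
    | mem f hf =>
      obtain ⟨U, hU, hc, rfl⟩ := hf
      exact hr U hU hc x hx
    | zero =>
      change x * (0 : SteinbergAlgebra K G) ∈ J
      rw [mul_zero]
      exact J.zero_mem
    | add f f' h h' e e' =>
      change x * ((⟨f, h⟩ : SteinbergAlgebra K G) + ⟨f', h'⟩) ∈ J
      rw [mul_add]
      exact J.add_mem e e'
    | smul c f h e =>
      change x * (c • (⟨f, h⟩ : SteinbergAlgebra K G)) ∈ J
      rw [mul_smul_comm]
      exact J.smul_mem c e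
  let I : TwoSidedIdeal (SteinbergAlgebra K G) := TwoSidedIdeal.mk' (J : Set _) J.zero_mem
    J.add_mem J.neg_mem (fun {x y} h => hl' x y h) (fun {x y} h => hr' x y h)
  have hI : ∀ x, x ∈ I ↔ x ∈ J := fun x => TwoSidedIdeal.mem_mk' ..
  rcases hs.simple.eq_bot_or_eq_top I with h | h
  · left
    rw [eq_bot_iff]
    intro x hx
    rw [← hI, h, TwoSidedIdeal.mem_bot] at hx
    exact hx
  · right
    rw [eq_top_iff]
    intro x _
    rw [← hI, h]
    trivial

/-- The elements of the Steinberg algebra which vanish on an open dense set. -/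
def singularIdeal (K : Type*) [CommRing K] (G : Type*) [TopologicalSpace G] [ArrowGroupoid G] :
    Submodule K (SteinbergAlgebra K G) where
  -- In this form, closure under addition follows by shrinking `W` twice.
  carrier := {f | ∀ W : Set G, IsOpen W → W.Nonempty →
    ∃ W' ⊆ W, IsOpen W' ∧ W'.Nonempty ∧ ∀ g ∈ W', f.1 g = 0}
  zero_mem' := fun W hW hne => ⟨W, subset_rfl, hW, hne, fun _ _ => rfl⟩
  add_mem' := by
    intro f f' h h' W hW hne
    obtain ⟨W₁, h₁, ho₁, hne₁, hc⟩ := h W hW hne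
    obtain ⟨W₂, h₂, ho₂, hne₂, hc'⟩ := h' W₁ ho₁ hne₁
    refine ⟨W₂, h₂.trans h₁, ho₂, hne₂, fun g hg => ?_⟩
    change f.1 g + f'.1 g = 0
    rw [hc g (h₂ hg), hc' g hg, add_zero]
  smul_mem' := by
    intro a f h W hW hne
    obtain ⟨W₁, h₁, ho₁, hne₁, hc⟩ := h W hW hne
    refine ⟨W₁, h₁, ho₁, hne₁, fun g hg => ?_⟩
    change a • f.1 g = 0
    rw [hc g hg, smul_zero]

/-- On some open subset of any given open set `f` is constant, and a non-zero constant would give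
the support an interior point. -/
theorem mem_singularIdeal_of_isSingular {f : SteinbergAlgebra K G} (hf : IsSingular f.1) :
    f ∈ singularIdeal K G := by
  intro W hW hne
  obtain ⟨W', hW', ho, ⟨g, hg⟩, c, hc⟩ := exists_isOpen_forall_eq f.2 hW hne
  refine ⟨W', hW', ho, ⟨g, hg⟩, ?_⟩
  have h0 : c = 0 := by
    by_contra h0
    have : g ∈ interior (Function.support f.1) :=
      mem_interior.2 ⟨W', fun x hx => by rwa [Function.mem_support, hc x hx], ho, hg⟩
    rw [hf] at this
    exact this
  rwa [h0] at hc

/-- The elements of the Steinberg algebra which vanish at all arrows with domain outside `X`. -/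
def supportedIdeal (K : Type*) [CommRing K] {G : Type*} [TopologicalSpace G] [ArrowGroupoid G]
    (X : Set (unitSpace G)) : Submodule K (SteinbergAlgebra K G) where
  carrier := {f | ∀ g, d g ∉ X → f.1 g = 0}
  zero_mem' := fun _ _ => rfl
  add_mem' := by
    intro f f' h h' g hg
    change f.1 g + f'.1 g = 0
    rw [h g hg, h' g hg, add_zero]
  smul_mem' := by
    intro a f h g hg
    change a • f.1 g = 0
    rw [h g hg, smul_zero]

theorem arrowSum_add {f f' : G → K} (hf : f ∈ SteinbergAlgebra K G)
    (hf' : f' ∈ SteinbergAlgebra K G) (x y : unitSpace G) :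
    arrowSum (f + f') x y = arrowSum f x y + arrowSum f' x y :=
  finsum_mem_add_distrib'
    ((finite_fiber hf y).subset fun _ hg => ⟨hg.1.2, hg.2⟩)
    ((finite_fiber hf' y).subset fun _ hg => ⟨hg.1.2, hg.2⟩)

theorem arrowSum_smul (a : K) {f : G → K} (hf : f ∈ SteinbergAlgebra K G) (x y : unitSpace G) :
    arrowSum (a • f) x y = a * arrowSum f x y :=
  ((AddMonoidHom.mulLeft a).map_finsum_mem' (f := f) (s := {g : G | d g = x ∧ r g = y})
    ((finite_fiber hf y).subset fun _ hg => ⟨hg.1.2, hg.2⟩)).symm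

theorem arrowSum_chi {U : Set G} (hU : IsLocalBisection U) {u : G} (hu : u ∈ U) :
    arrowSum (chi K U) (d u) (r u) = 1 := by
  rw [arrowSum, finsum_mem_def, finsum_eq_single _ u,
    Set.indicator_of_mem (s := {g : G | d g = d u ∧ r g = r u}) ⟨rfl, rfl⟩, chi_of_mem hu]
  intro g hne
  exact Set.indicator_apply_eq_zero.2 fun hg =>
    chi_of_notMem fun hgU => hne (hU.injOn_d hgU hu hg.1)

/-- The kernel of the action of the Steinberg algebra on the finitely supported functions on the
unit space. -/
noncomputable def actionKernel (K : Type*) [CommRing K] (G : Type*) [TopologicalSpace G]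
    [ArrowGroupoid G] : Submodule K (SteinbergAlgebra K G) where
  carrier := {f | ∀ x y, arrowSum f.1 x y = 0}
  zero_mem' := fun _ _ => finsum_mem_eq_zero_of_forall_eq_zero fun _ _ => rfl
  add_mem' := by
    intro f f' h h' x y
    exact (arrowSum_add f.2 f'.2 x y).trans (by rw [h, h', add_zero])
  smul_mem' := by
    intro a f h x y
    exact (arrowSum_smul a f.2 x y).trans (by rw [h, mul_zero])

/-- Left translation by `u` is a bijection from the arrows `x → d u` onto the arrows `x → r u`. With
its right-handed analogue, this makes `actionKernel` an ideal. -/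
theorem arrowSum_chi_conv {U : Set G} (hU : IsLocalBisection U) (f : G → K) {u : G} (hu : u ∈ U)
    (x : unitSpace G) : arrowSum (conv (chi K U) f) x (r u) = arrowSum f x (d u) := by
  symm
  refine finsum_mem_eq_of_bijOn (fun g => u * g) ⟨?_, ?_, ?_⟩ ?_
  · rintro g ⟨h, h'⟩
    exact ⟨(d_mul h'.symm).trans h, r_mul h'.symm⟩
  · rintro g ⟨-, h⟩ g' ⟨-, h'⟩ (e : u * g = u * g')
    rw [← inv_mul_cancel_left h.symm, e, inv_mul_cancel_left h'.symm]
  · rintro g ⟨h, h'⟩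
    have h2 : d u⁻¹ = r g := (d_inv u).trans h'.symm
    exact ⟨u⁻¹ * g, ⟨(d_mul h2).trans h, (r_mul h2).trans (r_inv u)⟩,
      mul_inv_cancel_left h'.symm⟩
  · rintro g ⟨-, h⟩
    exact (chi_conv_apply hU.injOn_r f hu h.symm).symm

theorem arrowSum_conv_chi {U : Set G} (hU : IsLocalBisection U) (f : G → K) {u : G} (hu : u ∈ U)
    (y : unitSpace G) : arrowSum (conv f (chi K U)) (d u) y = arrowSum f (r u) y := by
  symm
  refine finsum_mem_eq_of_bijOn (fun g => g * u) ⟨?_, ?_, ?_⟩ ?_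
  · rintro g ⟨h, h'⟩
    exact ⟨d_mul h, (r_mul h).trans h'⟩
  · rintro g ⟨h, -⟩ g' ⟨h', -⟩ (e : g * u = g' * u)
    rw [← mul_inv_cancel_right h, e, mul_inv_cancel_right h']
  · rintro g ⟨h, h'⟩
    have h2 : d g = r u⁻¹ := h.trans (r_inv u).symm
    exact ⟨g * u⁻¹, ⟨(d_mul h2).trans (d_inv u), (r_mul h2).trans h'⟩, inv_mul_cancel_right h⟩
  · rintro g ⟨h, -⟩
    exact (conv_chi_apply hU.injOn_d f hu h).symm

end ideals

/-! ### Simplicity implies the three conditions -/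

section necessity

variable {K : Type*} [CommRing K] {G : Type*} [TopologicalSpace G] [ArrowGroupoid G]
  [IsAmpleGroupoid G]

theorem eq_zero_of_isSingular_of_isSimpleRing [Nonempty G] [Nontrivial K]
    (hs : IsSimpleRing (SteinbergAlgebra K G)) {f : G → K} (hf : f ∈ SteinbergAlgebra K G)
    (hfs : IsSingular f) : f = 0 := by
  refine Or.elim (eq_bot_or_eq_top_of_isSimpleRing hs (singularIdeal K G) ?_ ?_)
    (fun h => ?_) (fun h => ?_)
  rotate_left 2
  · have hm : (⟨f, hf⟩ : SteinbergAlgebra K G) ∈ singularIdeal K G :=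
      mem_singularIdeal_of_isSingular hfs
    rw [h, Submodule.mem_bot] at hm
    exact congrArg Subtype.val hm
  · exfalso
    obtain ⟨U, -, hgU, hU, hc⟩ := exists_isCompact_isLocalBisection isOpen_univ
      (Set.mem_univ (Classical.arbitrary G))
    have hm : (⟨chi K U, chi_mem hU hc⟩ : SteinbergAlgebra K G) ∈ singularIdeal K G := by
      rw [h]; trivial
    obtain ⟨W, hW, -, ⟨g, hg⟩, h0⟩ := hm U hU.isOpen ⟨_, hgU⟩
    have : chi K U g = 0 := h0 g hg
    rw [chi_of_mem (hW hg)] at this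
    exact one_ne_zero this
  · intro U hU hc f hf W hW hne
    by_cases h : ∃ u ∈ U, ∃ g ∈ W, r u = r g
    · obtain ⟨u, hu, g, hg, hug⟩ := h
      -- Translate `W` back along `U`, find there an open set `D` on which `f` vanishes, and
      -- translate `D` forward: `setMul U D` lies in `W` and the product vanishes on it.
      obtain ⟨D, hDW, hD, hDne, h0⟩ := hf (setMul (setInv U) W) (isOpen_setMul hU.setInv hW)
        ⟨_, u⁻¹, inv_mem_setInv hu, g, hg, (d_inv u).trans hug, rfl⟩
      refine ⟨setMul U D, ?_, isOpen_setMul hU hD, ?_, ?_⟩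
      · rintro _ ⟨v, hv, δ, hδ, hvδ, rfl⟩
        obtain ⟨w, hw, g, hg, hwg, rfl⟩ := hDW hδ
        obtain rfl : v = w⁻¹ := hU.injOn_d hv hw (by rw [hvδ, r_mul hwg, d_inv])
        rwa [inv_mul_cancel_left hwg]
      · obtain ⟨δ, hδ⟩ := hDne
        obtain ⟨w, hw, g, hg, hwg, rfl⟩ := hDW hδ
        exact ⟨_, w⁻¹, hw, _, hδ, by rw [r_mul hwg, d_inv], rfl⟩
      · rintro _ ⟨v, hv, δ, hδ, hvδ, rfl⟩
        exact (chi_conv_apply hU.injOn_r _ hv hvδ).trans (h0 δ hδ)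
    · exact ⟨W, subset_rfl, hW, hne, fun g hg =>
        chi_conv_apply_eq_zero _ fun u hu e => h ⟨u, hu, g, hg, e⟩⟩
  · intro U hU hc f hf W hW hne
    by_cases h : ∃ u ∈ U, ∃ g ∈ W, d u = d g
    · obtain ⟨u, hu, g, hg, hug⟩ := h
      obtain ⟨D, hDW, hD, hDne, h0⟩ := hf (setMul W (setInv U))
        (isOpen_setMul_of_isLocalBisection_right hW hU.setInv)
        ⟨_, g, hg, u⁻¹, inv_mem_setInv hu, hug.symm.trans (r_inv u).symm, rfl⟩
      refine ⟨setMul D U, ?_, isOpen_setMul_of_isLocalBisection_right hD hU, ?_, ?_⟩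
      · rintro _ ⟨δ, hδ, v, hv, hvδ, rfl⟩
        obtain ⟨g, hg, w, hw, hwg, rfl⟩ := hDW hδ
        obtain rfl : v = w⁻¹ := hU.injOn_r hv hw (by rw [← hvδ, d_mul hwg, r_inv])
        rwa [mul_inv_cancel_right hwg]
      · obtain ⟨δ, hδ⟩ := hDne
        obtain ⟨g, hg, w, hw, hwg, rfl⟩ := hDW hδ
        exact ⟨_, _, hδ, w⁻¹, hw, by rw [d_mul hwg, r_inv], rfl⟩
      · rintro _ ⟨δ, hδ, v, hv, hvδ, rfl⟩
        exact (conv_chi_apply hU.injOn_d _ hv hvδ).trans (h0 δ hδ)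
    · exact ⟨W, subset_rfl, hW, hne, fun g hg =>
        conv_chi_apply_eq_zero _ fun u hu e => h ⟨u, hu, g, hg, e⟩⟩

theorem isMinimal_of_isSimpleRing [Nontrivial K] (hs : IsSimpleRing (SteinbergAlgebra K G)) :
    IsMinimal G := by
  intro X hX hinv
  refine Or.elim (eq_bot_or_eq_top_of_isSimpleRing hs (supportedIdeal K X) ?_ ?_)
    (fun h => ?_) (fun h => ?_)
  rotate_left 2
  · left
    by_contra hne
    obtain ⟨x, hx⟩ := Set.nonempty_iff_ne_empty.2 hne
    obtain ⟨g, rfl⟩ : ∃ g, d g = x := ⟨x.1, Subtype.ext (dom_of_mem_unitSpace x.2)⟩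
    obtain ⟨U, hUX, hgU, hU, hc⟩ := exists_isCompact_isLocalBisection
      (hX.preimage IsTopologicalGroupoid.continuous_d) hx
    have hm : (⟨chi K U, chi_mem hU hc⟩ : SteinbergAlgebra K G) ∈ supportedIdeal K X :=
      fun g hg => chi_of_notMem fun hgU => hg (hUX hgU)
    rw [h, Submodule.mem_bot] at hm
    have : chi K U g = 0 := congrFun (congrArg Subtype.val hm) g
    rw [chi_of_mem hgU] at this
    exact one_ne_zero this
  · right
    rw [Set.eq_univ_iff_forall]
    intro x
    obtain ⟨g, rfl⟩ : ∃ g, d g = x := ⟨x.1, Subtype.ext (dom_of_mem_unitSpace x.2)⟩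
    obtain ⟨U, -, hgU, hU, hc⟩ := exists_isCompact_isLocalBisection isOpen_univ (Set.mem_univ g)
    have hm : (⟨chi K U, chi_mem hU hc⟩ : SteinbergAlgebra K G) ∈ supportedIdeal K X := by
      rw [h]; trivial
    by_contra hg
    have : chi K U g = 0 := hm g hg
    rw [chi_of_mem hgU] at this
    exact one_ne_zero this
  · intro U hU hc f hf g hg
    rw [coe_mul_steinbergAlgebra]
    by_cases h : ∃ u ∈ U, r u = r g
    · obtain ⟨u, hu, hug⟩ := h
      have h2 : d u⁻¹ = r g := (d_inv u).trans hug
      rw [← mul_inv_cancel_left hug,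
        chi_conv_apply hU.injOn_r _ hu (by rw [r_mul h2, r_inv])]
      exact hf _ (by rwa [d_mul h2])
    · exact chi_conv_apply_eq_zero _ fun u hu e => h ⟨u, hu, e⟩
  · intro U hU hc f hf g hg
    rw [coe_mul_steinbergAlgebra]
    by_cases h : ∃ u ∈ U, d u = d g
    · obtain ⟨u, hu, hug⟩ := h
      have h2 : d g = r u⁻¹ := hug.symm.trans (r_inv u).symm
      rw [← inv_mul_cancel_right hug.symm,
        conv_chi_apply hU.injOn_d _ hu (by rw [d_mul h2, d_inv])]
      -- Left multiplication preserves domains, but right multiplication moves them along `U`.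
      -- Invariance of `X`, applied to `u⁻¹`, brings `r u ∈ X` back to `d u ∈ X`.
      refine hf _ fun hX' => hg ?_
      rw [d_mul h2, d_inv] at hX'
      exact hinv _ hX' ⟨u⁻¹, d_inv u, (r_inv u).trans hug⟩
    · exact conv_chi_apply_eq_zero _ fun u hu e => h ⟨u, hu, e⟩

theorem isEffective_of_isSimpleRing [Nontrivial K] (hs : IsSimpleRing (SteinbergAlgebra K G)) :
    IsEffective G := by
  refine (interior_maximal unitSpace_subset_isotropy isOpen_unitSpace).antisymm ?_
  intro g hg
  by_contra hgu
  obtain ⟨U, hUi, hgU, hU, hUc⟩ := exists_isCompact_isLocalBisection isOpen_interior hg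
  have hiso : ∀ u ∈ U, d u = r u := fun u hu =>
    interior_subset (s := isotropy G) (hUi hu)
  have hV : IsOpen (dom '' U) := isOpen_dom_image hU.isOpen
  have hVu : dom '' U ⊆ unitSpace G := by
    rintro _ ⟨u, -, rfl⟩
    exact dom_mem_unitSpace u
  have hVb := isLocalBisection_of_subset_unitSpace hV hVu
  have hVc : IsCompact (dom '' U) := hUc.image continuous_dom
  have hdd : ∀ u : G, d (dom u) = d u := fun u => Subtype.ext (dom_dom u)
  have hrd : ∀ u : G, r (dom u) = d u := fun u => Subtype.ext (cod_dom u)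
  refine Or.elim (eq_bot_or_eq_top_of_isSimpleRing hs (actionKernel K G) ?_ ?_)
    (fun h => ?_) (fun h => ?_)
  rotate_left 2
  -- An isotropy arrow `u` and the unit `dom u` have the same ends, so both functions have the same
  -- matrix coefficients; yet they differ at the non-unit `g`.
  · have hm : (⟨chi K U, chi_mem hU hUc⟩ - ⟨chi K (dom '' U), chi_mem hVb hVc⟩ :
        SteinbergAlgebra K G) ∈ actionKernel K G := by
      intro x y
      change arrowSum (chi K U - chi K (dom '' U)) x y = 0
      rw [sub_eq_add_neg, ← neg_one_smul K, arrowSum_add (chi_mem hU hUc)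
        (Submodule.smul_mem _ _ (chi_mem hVb hVc)), arrowSum_smul _ (chi_mem hVb hVc)]
      by_cases hxy : ∃ u ∈ U, d u = x ∧ r u = y
      · obtain ⟨u, hu, rfl, rfl⟩ := hxy
        have h1 := arrowSum_chi (K := K) hVb ⟨u, hu, rfl⟩
        rw [hdd, hrd] at h1
        have h2 := arrowSum_chi (K := K) hU hu
        rw [← hiso u hu] at h2 ⊢
        rw [h1, h2]
        ring
      · rw [arrowSum_chi_eq_zero (fun u hu hx hy => hxy ⟨u, hu, hx, hy⟩),
          arrowSum_chi_eq_zero, mul_zero, add_zero]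
        rintro _ ⟨u, hu, rfl⟩ hx hy
        exact hxy ⟨u, hu, (hdd u).symm.trans hx, (hiso u hu).symm.trans ((hrd u).symm.trans hy)⟩
    rw [h, Submodule.mem_bot] at hm
    have := congrFun (congrArg Subtype.val hm) g
    change chi K U g - chi K (dom '' U) g = 0 at this
    rw [chi_of_mem hgU, chi_of_notMem (fun h => hgu (hVu h)), sub_zero] at this
    exact one_ne_zero this
  · have hm : (⟨chi K U, chi_mem hU hUc⟩ : SteinbergAlgebra K G) ∈ actionKernel K G := by
      rw [h]; trivial
    have := hm (d g) (r g)
    rw [arrowSum_chi hU hgU] at this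
    exact one_ne_zero this
  · intro U hU hc f hf x y
    rw [coe_mul_steinbergAlgebra]
    by_cases h : ∃ u ∈ U, r u = y
    · obtain ⟨u, hu, rfl⟩ := h
      rw [arrowSum_chi_conv hU _ hu]
      exact hf _ _
    · exact finsum_mem_eq_zero_of_forall_eq_zero fun g hg =>
        chi_conv_apply_eq_zero _ fun u hu e => h ⟨u, hu, e.trans hg.2⟩
  · intro U hU hc f hf x y
    rw [coe_mul_steinbergAlgebra]
    by_cases h : ∃ u ∈ U, d u = x
    · obtain ⟨u, hu, rfl⟩ := h
      rw [arrowSum_conv_chi hU _ hu]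
      exact hf _ _
    · exact finsum_mem_eq_zero_of_forall_eq_zero fun g hg =>
        conv_chi_apply_eq_zero _ fun u hu e => h ⟨u, hu, e.trans hg.1⟩

end necessity


/-! ### Topological freeness, minimality and no singular functions imply simplicity -/

section sufficiency

variable {K : Type*} {G : Type*} [TopologicalSpace G] [ArrowGroupoid G]

/-- In a topologically free groupoid, cutting down an element of the Steinberg algebra to a small
enough open set leaves a multiple of a characteristic function of units. -/
theorem IsTopologicallyFree.exists_isOpen_forall_eq [CommRing K] [IsAmpleGroupoid G]
    (ht : IsTopologicallyFree G) {f : G → K} (hf : f ∈ SteinbergAlgebra K G) :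
    ∀ {V : Set G}, IsOpen V → V.Nonempty →
      ∃ V' ⊆ V, IsOpen V' ∧ V'.Nonempty ∧ ∃ c : K, ∀ g, dom g ∈ V' → cod g ∈ V' →
        f g = c * chi K (unitSpace G) g := by
  induction hf using Submodule.span_induction with
  | mem f hf =>
    obtain ⟨B, hB, -, rfl⟩ := hf
    intro V hV hne
    let C : Set G := B ∩ (dom ⁻¹' V ∩ cod ⁻¹' V)
    have hC : IsOpen C :=
      hB.isOpen.inter ((hV.preimage continuous_dom).inter (hV.preimage continuous_cod))
    -- Three cases for the part `C` of `B` with both ends in `V`. If `C` is isotropy and contains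
    -- units, these units form `V'`. If `C` is isotropy without units, topological freeness makes it
    -- empty. Otherwise an arrow of `C` has distinct ends, and separating them yields a `V'` such
    -- that no arrow of `B` has both ends in it.
    by_cases hiso : C ⊆ isotropy G
    · by_cases hCu : (C ∩ unitSpace G).Nonempty
      · refine ⟨C ∩ unitSpace G, ?_, hC.inter isOpen_unitSpace, hCu, 1, ?_⟩
        · rintro x ⟨⟨-, hx, -⟩, hxu⟩
          rwa [Set.mem_preimage, dom_of_mem_unitSpace hxu] at hx
        · rintro g ⟨⟨hgB, -⟩, -⟩ -
          by_cases hg : g ∈ unitSpace G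
          · rw [dom_of_mem_unitSpace hg] at hgB
            rw [chi_of_mem hgB, chi_of_mem hg, one_mul]
          · rw [chi_of_notMem hg, mul_zero]
            refine chi_of_notMem fun hgB' => hg ?_
            have : g = dom g := hB.injOn_d hgB' hgB (d_eq_d_iff.2 (dom_dom g).symm)
            exact ⟨g, this.symm⟩
      · have hCe : C = ∅ := by
          rw [← Set.subset_empty_iff, ← (show interior (isotropy G \ unitSpace G) = ∅ from ht)]
          exact interior_maximal (fun g hg => ⟨hiso hg, fun hu => hCu ⟨g, hg, hu⟩⟩) hC
        refine ⟨V, subset_rfl, hV, hne, 0, fun g hd hr => ?_⟩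
        rw [zero_mul]
        refine chi_of_notMem fun hgB => ?_
        have : g ∈ C := ⟨hgB, hd, hr⟩
        rwa [hCe] at this
    · obtain ⟨b, hb, hbi⟩ := Set.not_subset.1 hiso
      have := IsEtaleGroupoid.t2Space_unitSpace (G := G)
      obtain ⟨P, Q, hP, hQ, hbP, hbQ, hPQ⟩ := t2_separation (x := d b) (y := r b) hbi
      let D : Set G := C ∩ (d ⁻¹' P ∩ r ⁻¹' Q)
      have hD : IsOpen D := hC.inter ((hP.preimage IsTopologicalGroupoid.continuous_d).inter
        (hQ.preimage IsTopologicalGroupoid.continuous_r))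
      refine ⟨dom '' D, ?_, isOpen_dom_image hD, ⟨_, b, ⟨hb, hbP, hbQ⟩, rfl⟩, 0, ?_⟩
      · rintro _ ⟨g, hg, rfl⟩
        exact hg.1.2.1
      · rintro g ⟨a, ha, hag⟩ ⟨a', ha', hag'⟩
        rw [zero_mul]
        -- An arrow of `B` with domain in `dom '' D` belongs to `D`, so its range is in `Q`, whereas
        -- the points of `dom '' D` lie in `P`.
        refine chi_of_notMem fun hgB => ?_
        obtain rfl : a = g := hB.injOn_d ha.1.1 hgB (d_eq_d_iff.2 hag)
        have h1 : d a' ∈ P := ha'.2.1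
        rw [d_eq_r_iff.2 hag'] at h1
        exact Set.disjoint_left.1 hPQ h1 ha.2.2
  | zero =>
    exact fun {V} hV hne => ⟨V, subset_rfl, hV, hne, 0, fun _ _ _ => by simp⟩
  | add f f' _ _ h h' =>
    intro V hV hne
    obtain ⟨V₁, h₁, ho₁, hne₁, c, hc⟩ := h hV hne
    obtain ⟨V₂, h₂, ho₂, hne₂, c', hc'⟩ := h' ho₁ hne₁
    exact ⟨V₂, h₂.trans h₁, ho₂, hne₂, c + c', fun g hd hr => by
      rw [Pi.add_apply, hc g (h₂ hd) (h₂ hr), hc' g hd hr, add_mul]⟩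
  | smul a f _ h =>
    intro V hV hne
    obtain ⟨V₁, h₁, ho₁, hne₁, c, hc⟩ := h hV hne
    exact ⟨V₁, h₁, ho₁, hne₁, a * c, fun g hd hr => by
      rw [Pi.smul_apply, hc g hd hr, smul_eq_mul, _root_.mul_assoc]⟩

/-- If `G` is topologically free, then every ideal which contains a non-singular function contains
the characteristic function of a non-empty open set of units. -/
theorem IsTopologicallyFree.exists_chi_mem [Field K] [IsAmpleGroupoid G]
    (ht : IsTopologicallyFree G) (I : TwoSidedIdeal (SteinbergAlgebra K G))
    {f : SteinbergAlgebra K G} (hfI : f ∈ I) (hf : ¬ IsSingular f.1) :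
    ∃ V : Set G, IsOpen V ∧ V ⊆ unitSpace G ∧ V.Nonempty ∧
      ∃ h : chi K V ∈ SteinbergAlgebra K G, ⟨chi K V, h⟩ ∈ I := by
  obtain ⟨W₀, hW₀, ho₀, ⟨w, hw⟩, c, hc⟩ := ArrowGroupoid.exists_isOpen_forall_eq f.2
    isOpen_interior (Set.nonempty_iff_ne_empty.2 hf)
  have hc0 : c ≠ 0 := by
    rw [← hc w hw]
    exact interior_subset (hW₀ hw)
  obtain ⟨W, hWW, hwW, hW, hWc⟩ := exists_isCompact_isLocalBisection ho₀ hw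
  have hWi := chi_mem (K := K) hW.setInv (isCompact_setInv hWc)
  have hcod : cod '' W ⊆ unitSpace G := by
    rintro _ ⟨g, -, rfl⟩
    exact cod_mem_unitSpace g
  -- Since `cod g = g * g⁻¹`, the value of `f` at `g ∈ W` moves to the unit `cod g`.
  have hval : ∀ x ∈ cod '' W, conv f.1 (chi K (setInv W)) x = c := by
    rintro _ ⟨g, hg, rfl⟩
    rw [← mul_inv, conv_chi_apply hW.setInv.injOn_d _ (inv_mem_setInv hg) (r_inv g).symm,
      hc g (hWW hg)]
  obtain ⟨V', hV', ho', ⟨x, hx⟩, c', hc'⟩ := ht.exists_isOpen_forall_eq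
    (f * ⟨_, hWi⟩ : SteinbergAlgebra K G).2 (isOpen_cod_image hW.isOpen) ⟨_, w, hwW, rfl⟩
  rw [coe_mul_steinbergAlgebra] at hc'
  obtain rfl : c' = c := by
    have hxu := hcod (hV' hx)
    have h1 := hc' x (by rwa [dom_of_mem_unitSpace hxu]) (by rwa [cod_of_mem_unitSpace hxu])
    rw [hval x (hV' hx), chi_of_mem hxu, mul_one] at h1
    exact h1.symm
  obtain ⟨V, hVV, hxV, hVb, hVc⟩ := exists_isCompact_isLocalBisection ho' hx
  have hVu : V ⊆ unitSpace G := hVV.trans (hV'.trans hcod)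
  have hVm := chi_mem (K := K) hVb hVc
  refine ⟨V, hVb.isOpen, hVu, ⟨x, hxV⟩, hVm, ?_⟩
  -- Multiplying by `chi K V` on both sides restricts to arrows with both ends in `V`, where only
  -- units remain. The scalar sits on the factor `chi K V` because `I` is only known to absorb ring
  -- multiplication.
  have hmem : (c'⁻¹ • ⟨chi K V, hVm⟩ : SteinbergAlgebra K G) *
      (f * ⟨_, hWi⟩) * ⟨chi K V, hVm⟩ ∈ I :=
    I.mul_mem_right _ _ (I.mul_mem_left _ _ (I.mul_mem_right _ _ hfI))
  convert hmem
  rw [smul_mul_assoc, smul_mul_assoc]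
  funext g
  change chi K V g = c'⁻¹ * conv (conv (chi K V) (conv f.1 (chi K (setInv W)))) (chi K V) g
  rw [conv_chi_of_subset_unitSpace hVu, chi_conv_of_subset_unitSpace hVu]
  by_cases hd : dom g ∈ V
  · by_cases hr : cod g ∈ V
    · rw [chi_of_mem hd, chi_of_mem hr, hc' g (hVV hd) (hVV hr)]
      by_cases hg : g ∈ unitSpace G
      · rw [chi_of_mem hg, chi_of_mem (by rwa [dom_of_mem_unitSpace hg] at hd)]
        simp [hc0]
      · rw [chi_of_notMem hg, chi_of_notMem fun h => hg (hVu h)]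
        simp
    · rw [chi_of_notMem hr, chi_of_notMem]
      · simp
      · exact fun h => hr (by rwa [cod_of_mem_unitSpace (hVu h)])
  · rw [chi_of_notMem hd, chi_of_notMem]
    · simp
    · exact fun h => hd (by rwa [dom_of_mem_unitSpace (hVu h)])

/-- The units at which some characteristic function of units in the ideal `I` takes the value
one. -/
def idealUnits [CommRing K] [IsEtaleGroupoid G] (I : TwoSidedIdeal (SteinbergAlgebra K G)) :
    Set (unitSpace G) :=
  {x | ∃ V : Set G, IsOpen V ∧ V ⊆ unitSpace G ∧ x.1 ∈ V ∧
    ∃ h : chi K V ∈ SteinbergAlgebra K G, ⟨chi K V, h⟩ ∈ I}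

theorem isOpen_idealUnits [CommRing K] [IsEtaleGroupoid G]
    (I : TwoSidedIdeal (SteinbergAlgebra K G)) : IsOpen (idealUnits I) := by
  rw [isOpen_iff_mem_nhds]
  rintro x ⟨V, hV, hVu, hx, h⟩
  exact Filter.mem_of_superset ((hV.preimage continuous_subtype_val).mem_nhds hx)
    fun y hy => ⟨V, hV, hVu, hy, h⟩

/-- Conjugating by a compact bisection `U` through `g` turns an open set of units around `d g` into
one around `r g`, and its characteristic function is a product with a factor in `I`. -/
theorem isInvariant_idealUnits [CommRing K] [IsAmpleGroupoid G]
    (I : TwoSidedIdeal (SteinbergAlgebra K G)) : IsInvariant (idealUnits I) := by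
  rintro _ ⟨V, hV, hVu, hx, hm, hI⟩ _ ⟨g, rfl, rfl⟩
  obtain ⟨U, -, hgU, hU, hUc⟩ := exists_isCompact_isLocalBisection isOpen_univ (Set.mem_univ g)
  have hVb := isLocalBisection_of_subset_unitSpace hV hVu
  have hUm := chi_mem (K := K) hU hUc
  have hUi := chi_mem (K := K) hU.setInv (isCompact_setInv hUc)
  have hmem := I.mul_mem_right _ ⟨_, hUi⟩ (I.mul_mem_left ⟨_, hUm⟩ _ hI)
  have heq : conv (conv (chi K U) (chi K V)) (chi K (setInv U)) =
      chi K (setMul (setMul U V) (setInv U)) := by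
    rw [chi_conv_chi hU, chi_conv_chi (hU.setMul hVb)]
  have hgx : d g = r (dom g) := d_eq_r_iff.2 (cod_dom g).symm
  refine ⟨setMul (setMul U V) (setInv U),
    isOpen_setMul (hU.setMul hVb) hU.setInv.isOpen, ?_, ?_, ?_⟩
  · rintro _ ⟨_, ⟨u, hu, v, hv, huv, rfl⟩, w, hw, huw, rfl⟩
    rw [mul_of_mem_unitSpace (hVu hv) huv] at huw ⊢
    obtain rfl : u = w⁻¹ := hU.injOn_d hu hw (huw.trans (d_inv w).symm)
    rw [inv_mul]
    exact dom_mem_unitSpace w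
  · refine ⟨g, ⟨g, hgU, dom g, hx, hgx, mul_dom g⟩, g⁻¹, inv_mem_setInv hgU, (r_inv g).symm,
      mul_inv g⟩
  · rw [← heq]
    exact ⟨_, hmem⟩

/-- Split `f` into `f * chi K (V a)`, which lies in `I`, and a remainder with no support over `V a`.
Removing the sets one at a time makes it unnecessary to refine the cover to a disjoint one. -/
theorem mem_of_support_subset [CommRing K] [IsEtaleGroupoid G]
    (I : TwoSidedIdeal (SteinbergAlgebra K G)) {ι : Type*} (V : ι → Set G)
    (hVu : ∀ i, V i ⊆ unitSpace G) (hV : ∀ i, ∃ h : chi K (V i) ∈ SteinbergAlgebra K G,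
      ⟨chi K (V i), h⟩ ∈ I) (s : Finset ι) :
    ∀ f : SteinbergAlgebra K G, (∀ g, f.1 g ≠ 0 → ∃ i ∈ s, dom g ∈ V i) → f ∈ I := by
  classical
  induction s using Finset.induction_on with
  | empty =>
    intro f hf
    have : f = 0 := by
      apply Subtype.ext
      funext g
      by_contra h
      simpa using hf g h
    rw [this]
    exact I.zero_mem
  | insert a s _ ih =>
    intro f hf
    obtain ⟨hm, hI⟩ := hV a
    rw [← sub_add_cancel f (f * ⟨_, hm⟩)]
    refine I.add_mem (ih _ fun g hg => ?_) (I.mul_mem_left _ _ hI)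
    change f.1 g - conv f.1 (chi K (V a)) g ≠ 0 at hg
    rw [conv_chi_of_subset_unitSpace (hVu a)] at hg
    have hga : dom g ∉ V a := fun h => hg (by rw [chi_of_mem h, mul_one, sub_self])
    obtain ⟨i, hi, hgi⟩ := hf g fun h => hg (by rw [h, zero_mul, sub_self])
    rcases Finset.mem_insert.1 hi with rfl | hi
    · exact absurd hgi hga
    · exact ⟨i, hi, hgi⟩

theorem eq_top_of_idealUnits_eq_univ [CommRing K] [IsEtaleGroupoid G]
    (I : TwoSidedIdeal (SteinbergAlgebra K G)) (h : idealUnits I = Set.univ) : I = ⊤ := by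
  have hx : ∀ x : unitSpace G, x ∈ idealUnits I := fun x => h ▸ Set.mem_univ x
  choose V hV hVu hxV hVI using hx
  -- The algebra may lack a unit, so `I` is not known in advance to be closed under scalars; the
  -- induction therefore carries all multiples.
  have key : ∀ f (hf : f ∈ SteinbergAlgebra K G) (c : K),
      c • (⟨f, hf⟩ : SteinbergAlgebra K G) ∈ I := by
    intro f hf
    induction hf using Submodule.span_induction with
    | mem f hf =>
      obtain ⟨U, hU, hc, rfl⟩ := hf
      intro c
      obtain ⟨s, hs⟩ := (hc.image continuous_dom).elim_finite_subcover V hV (by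
        rintro _ ⟨g, -, rfl⟩
        exact Set.mem_iUnion.2 ⟨d g, hxV (d g)⟩)
      refine mem_of_support_subset I V hVu hVI s _ fun g hg => ?_
      change c • chi K U g ≠ 0 at hg
      have hgU : g ∈ U := by
        by_contra hgU
        exact hg (by rw [chi_of_notMem hgU, smul_zero])
      simpa using hs ⟨g, hgU, rfl⟩
    | zero =>
      intro c
      change c • (0 : SteinbergAlgebra K G) ∈ I
      rw [smul_zero]
      exact I.zero_mem
    | add f f' hf hf' e e' =>
      intro c
      change c • ((⟨f, hf⟩ : SteinbergAlgebra K G) + ⟨f', hf'⟩) ∈ I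
      rw [smul_add]
      exact I.add_mem (e c) (e' c)
    | smul a f hf e =>
      intro c
      change c • (a • (⟨f, hf⟩ : SteinbergAlgebra K G)) ∈ I
      rw [smul_smul]
      exact e _
  rw [eq_top_iff]
  intro f _
  have := key f.1 f.2 1
  rwa [one_smul] at this

theorem isSimpleRing_of_isTopologicallyFree [Field K] [IsAmpleGroupoid G] [Nonempty G]
    (ht : IsTopologicallyFree G) (hm : IsMinimal G)
    (hs : ∀ f ∈ SteinbergAlgebra K G, IsSingular f → f = 0) :
    IsSimpleRing (SteinbergAlgebra K G) := by
  have hnt : Nontrivial (SteinbergAlgebra K G) := by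
    obtain ⟨U, -, hgU, hU, hc⟩ := exists_isCompact_isLocalBisection isOpen_univ
      (Set.mem_univ (Classical.arbitrary G))
    refine ⟨⟨chi K U, chi_mem hU hc⟩, 0, fun h => ?_⟩
    have : chi K U _ = 0 := congrFun (congrArg Subtype.val h) (Classical.arbitrary G)
    rw [chi_of_mem hgU] at this
    exact one_ne_zero this
  refine ⟨{ toNontrivial := inferInstance, eq_bot_or_eq_top := fun I => ?_ }⟩
  by_cases hI : ∀ f ∈ I, f = 0
  · left
    rw [eq_bot_iff]
    exact fun f hf => (TwoSidedIdeal.mem_bot _).2 (hI f hf)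
  · right
    push Not at hI
    obtain ⟨f, hf, hf0⟩ := hI
    obtain ⟨V, hV, hVu, ⟨x, hx⟩, hVI⟩ := ht.exists_chi_mem I hf
      fun h => hf0 (Subtype.ext (hs f.1 f.2 h))
    apply eq_top_of_idealUnits_eq_univ
    rcases hm _ (isOpen_idealUnits I) (isInvariant_idealUnits I) with h | h
    · have : (⟨x, hVu hx⟩ : unitSpace G) ∈ idealUnits I := ⟨V, hV, hVu, hx, hVI⟩
      rw [h] at this
      exact absurd this (Set.notMem_empty _)
    · exact h

theorem IsEffective.isTopologicallyFree (h : IsEffective G) : IsTopologicallyFree G := by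
  rw [IsTopologicallyFree, Set.eq_empty_iff_forall_notMem]
  intro g hg
  have h1 : g ∈ unitSpace G := by
    rw [show unitSpace G = interior (isotropy G) from h]
    exact interior_mono Set.sdiff_subset hg
  exact (interior_subset hg).2 h1

end sufficiency

end ArrowGroupoid

theorem mainTheorem1 {G : Type*} [TopologicalSpace G] [ArrowGroupoid G]
    [ArrowGroupoid.IsAmpleGroupoid G] [Nonempty G] {K : Type*} [Field K] :
    (IsSimpleRing (ArrowGroupoid.SteinbergAlgebra K G) ↔
      ArrowGroupoid.IsEffective G ∧ ArrowGroupoid.IsMinimal G ∧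
        ∀ f ∈ ArrowGroupoid.SteinbergAlgebra K G, ArrowGroupoid.IsSingular f → f = 0) ∧
    (IsSimpleRing (ArrowGroupoid.SteinbergAlgebra K G) ↔
      ArrowGroupoid.IsTopologicallyFree G ∧ ArrowGroupoid.IsMinimal G ∧
        ∀ f ∈ ArrowGroupoid.SteinbergAlgebra K G, ArrowGroupoid.IsSingular f → f = 0) := by

  -- Necessity gives the stronger condition, effectiveness, while sufficiency uses the weaker one,
  -- topological freeness; so both equivalences follow together.
  have h1 (hs : IsSimpleRing (ArrowGroupoid.SteinbergAlgebra K G)) :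
      ArrowGroupoid.IsEffective G ∧ ArrowGroupoid.IsMinimal G ∧
        ∀ f ∈ ArrowGroupoid.SteinbergAlgebra K G, ArrowGroupoid.IsSingular f → f = 0 :=
    ⟨ArrowGroupoid.isEffective_of_isSimpleRing hs, ArrowGroupoid.isMinimal_of_isSimpleRing hs,
      fun _ hf => ArrowGroupoid.eq_zero_of_isSingular_of_isSimpleRing hs hf⟩
  have h2 := ArrowGroupoid.isSimpleRing_of_isTopologicallyFree (G := G) (K := K)
  exact ⟨⟨h1, fun h => h2 h.1.isTopologicallyFree h.2.1 h.2.2⟩,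
    ⟨fun hs => ⟨(h1 hs).1.isTopologicallyFree, (h1 hs).2⟩, fun h => h2 h.1 h.2.1 h.2.2⟩⟩
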